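/- Let $0<\alpha<1$ and $\sigma>0$. For each $n$ let $X_n\in\mathbb R^{n\times p_n}$, $\beta_n\in\mathbb R^{p_n}$, and consider the sequence of Gaussian linear models $y_n\sim N_n(X_n\beta_n,\sigma^2 I_n)$, where $X_n$ has full column rank $p_n<n$ for all sufficiently large $n$. Let $c_n=\|X_n\beta_n\|$, and let $P_n$ be the orthogonal projection onto the column space of $X_n$. The level-$\alpha$ $F$-test of $H_{0,n}:\beta_n=0$ rejects when $$F_n(y_n)=\frac{\|P_ny_n\|^2/p_n}{\|(I_n-P_n)y_n\|^2/(n-p_n)}>F_{p_n,\,n-p_n,\,1-\alpha},$$ where $F_{d_1,d_2,1-\alpha}$ is the $(1-\alpha)$-quantile of the $F$-distribution with $d_1$ and $d_2$ degrees of freedom. Let $\rho_n(c_n,p_n,\sigma^2)$ be its power, i.e. the probability of rejection under $N_n(X_n\beta_n,\sigma^2I_n)$. The following hold, where each hypothesis on $p_n$ or $c_n$ is needed only for all sufficiently large $n$ and the choice of $X_n,\beta_n$ is otherwise arbitrary. 1. If $p_n=p_0\ge 1$ and $c_n=c_0>0$ are constants, then $\alpha<\liminf_{n\to\infty}\rho_n(c_0,p_0,\sigma^2)<1$.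 2. If $\gamma\in(0,1)$, $p_n=\lfloor\gamma n\rfloor$, and $c_n=c_0$ is constant, then $\liminf_{n\to\infty}\rho_n(c_0,\lfloor\gamma n\rfloor,\sigma^2)=\alpha$. 3. If $\gamma\in(0,1)$, $p_n=\lfloor\gamma n\rfloor$, and $c_n=n^{1/4}$, then $\alpha<\liminf_{n\to\infty}\rho_n(n^{1/4},\lfloor\gamma n\rfloor,\sigma^2)<1$. -/

import Mathlib

open Filter MeasureTheory ProbabilityTheory

noncomputable section

/-- The chi-squared distribution with `d` degrees of freedom: the law of `z₁² + ⋯ + z_d²` for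
independent standard normal `z₁, …, z_d`, i.e. of `‖z‖²` for a standard Gaussian vector `z`. -/
def chiSquared (d : ℕ) : Measure ℝ :=
  (stdGaussian (EuclideanSpace ℝ (Fin d))).map (fun z => ‖z‖ ^ 2)

/-- The central `F`-distribution with `d₁` and `d₂` degrees of freedom: the law of
`(U / d₁) / (V / d₂)` for independent `U ∼ χ²(d₁)` and `V ∼ χ²(d₂)`. -/
def fDistribution (d₁ d₂ : ℕ) : Measure ℝ :=
  ((chiSquared d₁).prod (chiSquared d₂)).map (fun w => (w.1 / (d₁ : ℝ)) / (w.2 / (d₂ : ℝ)))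

/-- The `t`-quantile `inf {x | t ≤ μ(-∞, x]}` of a law `μ` on the real line. -/
def lawQuantile (μ : Measure ℝ) (t : ℝ) : ℝ :=
  sInf {x : ℝ | t ≤ μ.real (Set.Iic x)}

variable {n p : ℕ}

/-- The mean vector `X β` of the linear model, as a vector of Euclidean `n`-space. -/
def regressionMean (X : Matrix (Fin n) (Fin p) ℝ) (β : EuclideanSpace ℝ (Fin p)) :
    EuclideanSpace ℝ (Fin n) :=
  Matrix.toEuclideanLin X β

/-- The column space of `X`, as a subspace of Euclidean `n`-space. -/
def columnSpace (X : Matrix (Fin n) (Fin p) ℝ) : Submodule ℝ (EuclideanSpace ℝ (Fin n)) :=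
  LinearMap.range (Matrix.toEuclideanLin X)

/-- The Gaussian linear model: the law `N_n(X β, σ² I)` of the observation. -/
def gaussianLinearModel (X : Matrix (Fin n) (Fin p) ℝ) (β : EuclideanSpace ℝ (Fin p)) (σ : ℝ) :
    Measure (EuclideanSpace ℝ (Fin n)) :=
  multivariateGaussian (regressionMean X β) (σ ^ 2 • (1 : Matrix (Fin n) (Fin n) ℝ))

/-- The `F`-statistic `(‖P y‖² / p) / (‖(I - P) y‖² / (n - p))`, with `P` the orthogonal
projection onto the column space of `X`. -/
def fStatistic (X : Matrix (Fin n) (Fin p) ℝ) (y : EuclideanSpace ℝ (Fin n)) : ℝ :=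
  (‖(columnSpace X).starProjection y‖ ^ 2 / (p : ℝ)) /
    (‖y - (columnSpace X).starProjection y‖ ^ 2 / ((n : ℝ) - (p : ℝ)))

/-- The rejection region of the level-`α` `F`-test of `β = 0` (for `X` of rank `p < n`): the
`F`-statistic exceeds the `(1 - α)`-quantile of the `F`-distribution with `p` and `n - p`
degrees of freedom. -/
def fTestRejectionRegion (α : ℝ) (X : Matrix (Fin n) (Fin p) ℝ) :
    Set (EuclideanSpace ℝ (Fin n)) :=
  {y | lawQuantile (fDistribution p (n - p)) (1 - α) < fStatistic X y}

/-- The power of the level-`α` `F`-test of `β = 0` when the observation has law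
`N_n(X β, σ² I)`: the probability of rejection. -/
def fTestPower (α σ : ℝ) (X : Matrix (Fin n) (Fin p) ℝ) (β : EuclideanSpace ℝ (Fin p)) : ℝ :=
  (gaussianLinearModel X β σ).real (fTestRejectionRegion α X)

end

/-!
In an orthonormal basis adapted to the column space, whose first vector points in the direction of
the mean, the `F`-statistic becomes
`(((z₀ + δ)² + z₁² + ⋯ + z_{p-1}²) / p) / ((w₀² + ⋯ + w_{m-1}²) / m)`
with independent standard normal `zᵢ, wⱼ`, `δ = ‖X β‖ / σ` and `m = n - p`; its null distribution
is the case `δ = 0`. So all the powers can be computed on one probability space carrying two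
infinite sequences of standard normals (`fTestPower_eq`, `fDistribution_eq_map_fRatio`), and the
dependence on `X` and `β` is gone, except through `δ`.

If `a (G - b)` has a limit law under the null hypothesis and `a (H - b)` has one under the
alternative, for the same affine normalization, then the suitably normalized critical value
converges to the `(1 - α)`-quantile `q` of the first law, and the power converges to the mass that
the second law gives to `(q, ∞)` (`tendsto_measureReal_lawQuantile_lt`).

* For fixed `p` the denominator tends to `1` by the strong law of large numbers, so that the two
  laws are those of `‖z‖² / p` and `‖z + δ e₀‖² / p`. The power tends to a limit above `α` because
  an interval centred at `0` has larger Gaussian mass than its translates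
  (`measure_shiftedSqSum_le_lt`).
* For `p ∼ γ n` the normalization is `√n (F - 1)`. By the central limit theorem for the two sums of
  squares and Slutsky's theorem, the limit laws are `N(0, V)` and `N(d / γ, V)`, where
  `d = lim δ² / √n` (`tendsto_cdf_fRatio`). Now `d = 0` when the signal strength is fixed, so that
  the limit is `α`, while `d = 1 / σ²` when it is `n ^ (1 / 4)`.

In every case the power converges, so its limit is its lower limit.
-/

open scoped Topology NNReal

/-! ### Limits of laws and of quantiles -/

/-- Convergence in distribution gives convergence of the distribution functions at each point that
is not an atom of the limit. -/
lemma tendsto_cdf_of_tendstoInDistribution {Ω Ω' : Type*} [MeasurableSpace Ω] [MeasurableSpace Ω']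
    {P : Measure Ω} [IsProbabilityMeasure P] {P' : Measure Ω'} [IsProbabilityMeasure P']
    {G : ℕ → Ω → ℝ} {Y : Ω' → ℝ} {l : Filter ℕ}
    (h : TendstoInDistribution G l Y (fun _ => P) P') (x : ℝ) (hx : P' {ω | Y ω = x} = 0) :
    Tendsto (fun n => P.real {ω | G n ω ≤ x}) l (𝓝 (P'.real {ω | Y ω ≤ x})) := by
  have h1 := h.tendsto
  have h2 := ProbabilityMeasure.tendsto_measure_of_null_frontier_of_tendsto' h1
    (E := Set.Iic x) (by
      simp only [ProbabilityMeasure.coe_mk]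
      rw [frontier_Iic, Measure.map_apply_of_aemeasurable h.aemeasurable_limit (by simp)]
      exact hx)
  simp only [ProbabilityMeasure.coe_mk] at h2
  rw [Measure.map_apply_of_aemeasurable h.aemeasurable_limit measurableSet_Iic] at h2
  have h3 := (ENNReal.tendsto_toReal (measure_ne_top _ _)).comp h2
  refine h3.congr fun n => ?_
  simp only [Function.comp]
  rw [Measure.map_apply_of_aemeasurable (h.forall_aemeasurable n) measurableSet_Iic]
  rfl

/-- If the distribution functions of `a (G - b)` converge to `Φ`, and `Φ` crosses the level `t`
strictly at `q`, then the normalized quantiles converge to `q`. The laws of the `G n` may have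
atoms. -/
lemma tendsto_lawQuantile {Ω : Type*} [MeasurableSpace Ω] {P : Measure Ω} [IsProbabilityMeasure P]
    {G : ℕ → Ω → ℝ} (hG : ∀ n, Measurable (G n)) {a b : ℕ → ℝ} (ha : ∀ᶠ n in atTop, 0 < a n)
    {Φ : ℝ → ℝ} {t q : ℝ}
    (hΦ : ∀ x, Tendsto (fun n => P.real {ω | a n * (G n ω - b n) ≤ x}) atTop (𝓝 (Φ x)))
    (hlt : ∀ x < q, Φ x < t) (hgt : ∀ x > q, t < Φ x) :
    Tendsto (fun n => a n * (lawQuantile (P.map (G n)) t - b n)) atTop (𝓝 q) := by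
  have hset : ∀ n, ∀ x, 0 < a n → (P.map (G n)).real (Set.Iic (b n + x / a n)) =
      P.real {ω | a n * (G n ω - b n) ≤ x} := by
    intro n x hn
    rw [map_measureReal_apply (hG n) measurableSet_Iic]
    congr 1
    ext ω
    simp only [Set.mem_preimage, Set.mem_Iic, Set.mem_ofPred_eq]
    rw [← sub_le_iff_le_add', le_div_iff₀ hn, mul_comm]
  -- points below `q` are eventually strict lower bounds of the set defining the quantile
  have hlow : ∀ x < q, ∀ᶠ n in atTop,
      ∀ y ∈ {y : ℝ | t ≤ (P.map (G n)).real (Set.Iic y)}, b n + x / a n ≤ y := by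
    intro x hx
    filter_upwards [(hΦ x).eventually_lt_const (hlt x hx), ha] with n hn han y hy
    by_contra! hyx
    have : (P.map (G n)).real (Set.Iic y) ≤ (P.map (G n)).real (Set.Iic (b n + x / a n)) :=
      measureReal_mono (Set.Iic_subset_Iic.2 hyx.le) (by
        have := Measure.isProbabilityMeasure_map (μ := P) (hG n).aemeasurable
        exact measure_ne_top _ _)
    rw [hset n x han] at this
    exact absurd (lt_of_le_of_lt (le_trans hy this) hn) (lt_irrefl _)
  have hup : ∀ x > q, ∀ᶠ n in atTop,
      b n + x / a n ∈ {y : ℝ | t ≤ (P.map (G n)).real (Set.Iic y)} := by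
    intro x hx
    filter_upwards [(hΦ x).eventually_const_lt (hgt x hx), ha] with n hn han
    rw [hset n x han]
    exact hn.le
  refine tendsto_order.2 ⟨fun x hx => ?_, fun x hx => ?_⟩
  · obtain ⟨x', hx', hx'q⟩ := exists_between hx
    filter_upwards [hlow x' hx'q, hup (q + 1) (by simp), ha] with n h1 h2 han
    have : b n + x' / a n ≤ lawQuantile (P.map (G n)) t := le_csInf ⟨_, h2⟩ h1
    rw [← le_sub_iff_add_le', div_le_iff₀ han] at this
    linarith [mul_comm (a n) (lawQuantile (P.map (G n)) t - b n)]
  · obtain ⟨x', hx'q, hx'⟩ := exists_between hx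
    filter_upwards [hlow (q - 1) (by simp), hup x' hx'q, ha] with n h1 h2 han
    have : lawQuantile (P.map (G n)) t ≤ b n + x' / a n := csInf_le ⟨_, h1⟩ h2
    rw [← sub_le_iff_le_add', le_div_iff₀ han] at this
    linarith [mul_comm (a n) (lawQuantile (P.map (G n)) t - b n)]

/-- Pointwise convergence of distribution functions, evaluated along a convergent sequence of
points; monotonicity replaces uniform convergence. -/
lemma tendsto_measureReal_le_of_tendsto {Ω : Type*} [MeasurableSpace Ω] {P : Measure Ω}
    [IsProbabilityMeasure P] {H : ℕ → Ω → ℝ} {Ψ : ℝ → ℝ} {q : ℝ} {s : ℕ → ℝ}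
    (hΨ : ∀ x, Tendsto (fun n => P.real {ω | H n ω ≤ x}) atTop (𝓝 (Ψ x)))
    (hc : ContinuousAt Ψ q) (hs : Tendsto s atTop (𝓝 q)) :
    Tendsto (fun n => P.real {ω | H n ω ≤ s n}) atTop (𝓝 (Ψ q)) := by
  refine tendsto_order.2 ⟨fun c hcq => ?_, fun c hcq => ?_⟩
  · have h1 : ∀ᶠ x in 𝓝[<] q, c < Ψ x :=
      (hc.eventually_const_lt hcq).filter_mono nhdsWithin_le_nhds
    obtain ⟨x, hx, hxq⟩ := (h1.and self_mem_nhdsWithin).exists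
    filter_upwards [(hΨ x).eventually_const_lt hx, hs.eventually_const_lt hxq] with n h2 h3
    exact h2.trans_le (measureReal_mono fun ω (hω : _ ≤ _) => hω.trans h3.le)
  · have h1 : ∀ᶠ x in 𝓝[>] q, Ψ x < c :=
      (hc.eventually_lt_const hcq).filter_mono nhdsWithin_le_nhds
    obtain ⟨x, hx, hxq⟩ := (h1.and self_mem_nhdsWithin).exists
    filter_upwards [(hΨ x).eventually_lt_const hx, hs.eventually_lt_const hxq] with n h2 h3
    exact lt_of_le_of_lt (measureReal_mono fun ω (hω : _ ≤ _) => hω.trans h3.le) h2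

/-- Limit of the power of a test that rejects when `H` exceeds the `t`-quantile of `G`, when `G` and
`H` have limiting distribution functions `Φ` and `Ψ` after the same affine normalization. -/
theorem tendsto_measureReal_lawQuantile_lt {Ω : Type*} [MeasurableSpace Ω] {P : Measure Ω}
    [IsProbabilityMeasure P] {G H : ℕ → Ω → ℝ} (hG : ∀ n, Measurable (G n))
    (hH : ∀ n, Measurable (H n)) {a b : ℕ → ℝ} (ha : ∀ᶠ n in atTop, 0 < a n)
    {Φ Ψ : ℝ → ℝ} {t q : ℝ}
    (hΦ : ∀ x, Tendsto (fun n => P.real {ω | a n * (G n ω - b n) ≤ x}) atTop (𝓝 (Φ x)))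
    (hΨ : ∀ x, Tendsto (fun n => P.real {ω | a n * (H n ω - b n) ≤ x}) atTop (𝓝 (Ψ x)))
    (hlt : ∀ x < q, Φ x < t) (hgt : ∀ x > q, t < Φ x) (hc : ContinuousAt Ψ q) :
    Tendsto (fun n => P.real {ω | lawQuantile (P.map (G n)) t < H n ω}) atTop (𝓝 (1 - Ψ q)) := by
  have h1 := tendsto_measureReal_le_of_tendsto hΨ hc (tendsto_lawQuantile hG ha hΦ hlt hgt)
  refine (h1.const_sub 1).congr' ?_
  filter_upwards [ha] with n han
  rw [← probReal_compl_eq_one_sub (measurableSet_le (by fun_prop) (by fun_prop))]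
  congr 1
  ext ω
  simp [han]

lemma continuousAt_measureReal_le {Ω : Type*} [MeasurableSpace Ω] {P : Measure Ω}
    [IsProbabilityMeasure P] {Y : Ω → ℝ} (hY : Measurable Y) {x : ℝ} (hx : P {ω | Y ω = x} = 0) :
    ContinuousAt (fun x => P.real {ω | Y ω ≤ x}) x := by
  -- along `u → x`, the event `Y ≤ u n` is `Y - (u n - x) ≤ x`, and `Y - (u n - x) → Y` pointwise
  refine tendsto_of_seq_tendsto fun u hu => ?_
  have h : TendstoInDistribution (fun n ω => Y ω - (u n - x)) atTop Y (fun _ => P) P := by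
    refine tendstoInDistribution_of_ae_tendsto (fun n => by fun_prop) (by fun_prop)
      (ae_of_all _ fun ω => ?_)
    simpa using (hu.sub_const x).const_sub (Y ω)
  refine (tendsto_cdf_of_tendstoInDistribution h x hx).congr fun n => ?_
  congr 1
  ext ω
  simp only [Set.mem_ofPred_eq]
  constructor <;> intro <;> linarith

/-- A distribution function without jumps that is strictly increasing wherever it is positive
crosses each level in `(0, 1)` strictly at a single point. -/
lemma exists_isolated_quantile {Ω : Type*} [MeasurableSpace Ω] {P : Measure Ω}
    [IsProbabilityMeasure P] {Y : Ω → ℝ} (hY : Measurable Y) (hatom : ∀ x, P {ω | Y ω = x} = 0)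
    (hsupp : ∀ x y, x < y → 0 < P {ω | Y ω ≤ y} → 0 < P {ω | x < Y ω ∧ Y ω ≤ y})
    {t : ℝ} (ht0 : 0 < t) (ht1 : t < 1) :
    ∃ q, P.real {ω | Y ω ≤ q} = t ∧ (∀ x < q, P.real {ω | Y ω ≤ x} < t) ∧
      ∀ x > q, t < P.real {ω | Y ω ≤ x} := by
  have hprob := Measure.isProbabilityMeasure_map (μ := P) hY.aemeasurable
  have hcdf : ∀ x, cdf (P.map Y) x = P.real {ω | Y ω ≤ x} := fun x => by
    rw [cdf_eq_real, map_measureReal_apply hY measurableSet_Iic]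
    rfl
  have hcont : Continuous fun x => P.real {ω | Y ω ≤ x} :=
    continuous_iff_continuousAt.2 fun x => continuousAt_measureReal_le hY (hatom x)
  have hstrict : ∀ x y, x < y → 0 < P.real {ω | Y ω ≤ y} →
      P.real {ω | Y ω ≤ x} < P.real {ω | Y ω ≤ y} := by
    intro x y hxy hy
    have h1 : {ω | Y ω ≤ y} = {ω | Y ω ≤ x} ∪ {ω | x < Y ω ∧ Y ω ≤ y} := by
      ext ω
      simp only [Set.mem_ofPred_eq, Set.mem_union]
      grind
    have hd : Disjoint {ω | Y ω ≤ x} {ω | x < Y ω ∧ Y ω ≤ y} :=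
      Set.disjoint_left.2 fun ω (h : _ ≤ _) h' => absurd h (not_le.2 h'.1)
    have hm : MeasurableSet {ω | x < Y ω ∧ Y ω ≤ y} :=
      (measurableSet_lt measurable_const hY).inter (measurableSet_le hY measurable_const)
    have h2 := hsupp x y hxy (ENNReal.toReal_pos_iff.1 hy).1
    rw [h1, measureReal_union hd hm]
    have : 0 < P.real {ω | x < Y ω ∧ Y ω ≤ y} := ENNReal.toReal_pos h2.ne' (measure_ne_top _ _)
    linarith
  obtain ⟨x₁, h₁⟩ := ((tendsto_cdf_atBot (P.map Y)).eventually_lt_const ht0).exists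
  obtain ⟨x₂, h₂⟩ := ((tendsto_cdf_atTop (P.map Y)).eventually_const_lt ht1).exists
  rw [hcdf] at h₁ h₂
  obtain ⟨q, hq⟩ := mem_range_of_exists_le_of_exists_ge hcont ⟨x₁, h₁.le⟩ ⟨x₂, h₂.le⟩
  simp only at hq
  refine ⟨q, hq, fun x hx => hq ▸ hstrict x q hx (hq ▸ ht0), fun x hx => ?_⟩
  have hle : P.real {ω | Y ω ≤ q} ≤ P.real {ω | Y ω ≤ x} :=
    measureReal_mono fun ω (h : _ ≤ _) => h.trans hx.le
  exact hq ▸ hstrict q x hx (by linarith)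

/-! ### Reduction to two sequences of standard normals -/

/-- The law of a sequence of independent standard normal variables. -/
noncomputable def gaussianSeq : Measure (ℕ → ℝ) := Measure.infinitePi fun _ => gaussianReal 0 1

instance : IsProbabilityMeasure gaussianSeq := by
  unfold gaussianSeq; infer_instance

/-- The law of two independent sequences of independent standard normal variables; the first drives
the numerator of the `F`-ratio and the second its denominator. -/
noncomputable def gaussianSeqPair : Measure ((ℕ → ℝ) × (ℕ → ℝ)) := gaussianSeq.prod gaussianSeq

instance : IsProbabilityMeasure gaussianSeqPair := by
  unfold gaussianSeqPair; infer_instance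

/-- The sum of squares of the first `k` terms of a sequence. -/
def sqSum (k : ℕ) (z : ℕ → ℝ) : ℝ := ∑ i ∈ Finset.range k, z i ^ 2

/-- The sum of squares of the first `k` terms of a sequence after `δ` has been added to its term of
index `0`, in expanded form. The two agree for `k ≥ 1`. -/
def shiftedSqSum (δ : ℝ) (k : ℕ) (z : ℕ → ℝ) : ℝ := sqSum k z + 2 * δ * z 0 + δ ^ 2

/-- The `F`-ratio with noncentrality `δ` in the numerator and `p`, `m` degrees of freedom. -/
noncomputable def fRatio (δ : ℝ) (p m : ℕ) (ω : (ℕ → ℝ) × (ℕ → ℝ)) : ℝ :=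
  (shiftedSqSum δ p ω.1 / p) / (sqSum m ω.2 / m)

@[fun_prop]
lemma continuous_sqSum (k : ℕ) : Continuous (sqSum k) := by
  unfold sqSum; fun_prop

@[fun_prop]
lemma continuous_shiftedSqSum (δ : ℝ) (k : ℕ) : Continuous (shiftedSqSum δ k) := by
  unfold shiftedSqSum; fun_prop

@[fun_prop]
lemma measurable_sqSum (k : ℕ) : Measurable (sqSum k) := (continuous_sqSum k).measurable

@[fun_prop]
lemma measurable_shiftedSqSum (δ : ℝ) (k : ℕ) : Measurable (shiftedSqSum δ k) :=
  (continuous_shiftedSqSum δ k).measurable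

@[fun_prop]
lemma measurable_fRatio (δ : ℝ) (p m : ℕ) : Measurable (fRatio δ p m) := by
  unfold fRatio; fun_prop

lemma shiftedSqSum_zero (k : ℕ) (z : ℕ → ℝ) : shiftedSqSum 0 k z = sqSum k z := by
  simp [shiftedSqSum]

lemma map_gaussianSeq_fin (k : ℕ) :
    gaussianSeq.map (fun z (i : Fin k) => z i) = Measure.pi fun _ => gaussianReal 0 1 := by
  rw [gaussianSeq, Measure.map_infinitePi_infinitePi_of_inj Fin.val_injective,
    Measure.infinitePi_eq_pi]

lemma map_sqSum_gaussianSeq (k : ℕ) : gaussianSeq.map (sqSum k) = chiSquared k := by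
  rw [chiSquared, ← map_pi_eq_stdGaussian, ← map_gaussianSeq_fin k,
    Measure.map_map (by fun_prop) (by fun_prop), Measure.map_map (by fun_prop) (by fun_prop)]
  congr 1
  ext z
  simp [EuclideanSpace.real_norm_sq_eq, sqSum, Finset.sum_range]

lemma fDistribution_eq_map_fRatio (p m : ℕ) :
    fDistribution p m = gaussianSeqPair.map (fRatio 0 p m) := by
  rw [fDistribution, ← map_sqSum_gaussianSeq, ← map_sqSum_gaussianSeq,
    Measure.map_prod_map _ _ (by fun_prop) (by fun_prop),
    Measure.map_map (by fun_prop) (by fun_prop)]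
  congr 1
  ext ω
  simp [fRatio, shiftedSqSum_zero]

lemma gaussianLinearModel_eq_map {n p : ℕ} (X : Matrix (Fin n) (Fin p) ℝ)
    (β : EuclideanSpace ℝ (Fin p)) {σ : ℝ} (hσ : 0 < σ) :
    gaussianLinearModel X β σ =
      (stdGaussian (EuclideanSpace ℝ (Fin n))).map (fun z => regressionMean X β + σ • z) := by
  open scoped MatrixOrder Matrix.Norms.L2Operator in
  have h : CFC.sqrt (σ ^ 2 • (1 : Matrix (Fin n) (Fin n) ℝ)) = σ • 1 := by
    have h0 : 0 ≤ σ • (1 : Matrix (Fin n) (Fin n) ℝ) := (Matrix.PosSemidef.one.smul hσ.le).nonneg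
    exact CFC.sqrt_unique (by simp [pow_two, smul_smul]) h0
  rw [gaussianLinearModel, multivariateGaussian, h]
  simp

/-- An orthonormal basis adapted to `U ⊕ Uᗮ` whose first vector is in the direction of a given
vector of `U`. -/
lemma exists_adapted_orthonormalBasis {E : Type*} [NormedAddCommGroup E] [InnerProductSpace ℝ E]
    [FiniteDimensional ℝ E] {p m : ℕ} {U : Submodule ℝ E} (hp : 0 < p)
    (hU : Module.finrank ℝ U = p) (hE : Module.finrank ℝ E = p + m) {u : E} (hu : u ∈ U) :
    ∃ b : OrthonormalBasis (Fin p ⊕ Fin m) ℝ E, (∀ i, b (.inl i) ∈ U) ∧ (∀ j, b (.inr j) ∈ Uᗮ) ∧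
      u = ‖u‖ • b (.inl ⟨0, hp⟩) := by
  have h1 : ∃ c : OrthonormalBasis (Fin p) ℝ U, u = ‖u‖ • (c ⟨0, hp⟩ : E) := by
    -- for `u = 0` any orthonormal basis will do
    by_cases h0 : u = 0
    · exact ⟨(stdOrthonormalBasis ℝ U).reindex (finCongr hU), by simp [h0]⟩
    · have hn : ‖u‖ ≠ 0 := norm_ne_zero_iff.2 h0
      have hv : Orthonormal ℝ (({⟨0, hp⟩} : Set (Fin p)).domRestrict
          (fun _ => (⟨‖u‖⁻¹ • u, U.smul_mem _ hu⟩ : U))) := by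
        refine ⟨fun i => ?_, fun i j hij => absurd (Subsingleton.elim i j) hij⟩
        simp [Set.domRestrict, norm_smul, hn]
      obtain ⟨c, hc⟩ := hv.exists_orthonormalBasis_extension_of_card_eq (by simpa using hU)
      refine ⟨c, ?_⟩
      rw [hc _ rfl]
      simp [smul_smul, hn]
  obtain ⟨c, hc⟩ := h1
  have hv : Orthonormal ℝ ((Set.range (Sum.inl : Fin p → Fin p ⊕ Fin m)).domRestrict
      (Sum.elim (fun i => (c i : E)) 0)) := by
    have h2 : Orthonormal ℝ fun i => (c i : E) := c.orthonormal.comp_linearIsometry U.subtypeₗᵢ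
    constructor
    · rintro ⟨_, i, rfl⟩
      simpa [Set.domRestrict] using h2.1 i
    · rintro ⟨_, i, rfl⟩ ⟨_, j, rfl⟩ hij
      simpa [Set.domRestrict] using h2.2 (i := i) (j := j) (by rintro rfl; exact hij rfl)
  obtain ⟨b, hb⟩ := hv.exists_orthonormalBasis_extension_of_card_eq (by simpa using hE)
  have hb' : ∀ i, b (.inl i) = c i := fun i => hb _ ⟨i, rfl⟩
  refine ⟨b, fun i => by rw [hb']; exact (c i).2, fun j => ?_, by rw [hb']; exact hc⟩
  rw [Submodule.mem_orthogonal]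
  intro v hv
  have h3 : v = ∑ i, c.repr ⟨v, hv⟩ i • b (.inl i) := by
    have := congrArg Subtype.val (c.sum_repr ⟨v, hv⟩)
    simpa [hb'] using this.symm
  rw [h3, sum_inner]
  refine Finset.sum_eq_zero fun i _ => ?_
  rw [inner_smul_left, b.inner_eq_zero (by simp), mul_zero]

/-- The `F`-statistic of an observation given by its coordinates in an adapted basis. -/
lemma fStatistic_eq {n p m : ℕ} (X : Matrix (Fin n) (Fin p) ℝ) (hn : n = p + m)
    (hp : 0 < p) (b : OrthonormalBasis (Fin p ⊕ Fin m) ℝ (EuclideanSpace ℝ (Fin n)))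
    (hb : ∀ i, b (.inl i) ∈ columnSpace X) (hb' : ∀ j, b (.inr j) ∈ (columnSpace X)ᗮ)
    {c σ : ℝ} (hσ : 0 < σ) (z w : ℕ → ℝ) :
    fStatistic X (c • b (.inl ⟨0, hp⟩) + σ • ∑ i, Sum.elim (fun i : Fin p => z i)
      (fun j : Fin m => w j) i • b i) = fRatio (c / σ) p m (z, w) := by
  have hres : c • b (.inl ⟨0, hp⟩) + σ • ∑ i, Sum.elim (fun i : Fin p => z i)
      (fun j : Fin m => w j) i • b i - ∑ i : Fin p, (σ * z i + if i = ⟨0, hp⟩ then c else 0) •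
        b (.inl i) = ∑ j : Fin m, (σ * w j) • b (.inr j) := by
    simp only [add_smul, Finset.sum_add_distrib, ite_smul, Fintype.sum_sum_type,
      Sum.elim_inl, Sum.elim_inr, zero_smul, Finset.sum_ite_eq', Finset.mem_univ, if_true,
      smul_add]
    simp only [Finset.smul_sum, smul_smul]
    abel
  have hproj : (columnSpace X).starProjection (c • b (.inl ⟨0, hp⟩) + σ • ∑ i, Sum.elim
      (fun i : Fin p => z i) (fun j : Fin m => w j) i • b i) =
      ∑ i : Fin p, (σ * z i + if i = ⟨0, hp⟩ then c else 0) • b (.inl i) := by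
    refine Submodule.eq_starProjection_of_mem_orthogonal
      (Submodule.sum_mem _ fun i _ => Submodule.smul_mem _ _ (hb i)) ?_
    rw [hres]
    exact Submodule.sum_mem _ fun i _ => Submodule.smul_mem _ _ (hb' i)
  have hbl : Orthonormal ℝ fun i => b (.inl i) := b.orthonormal.comp _ Sum.inl_injective
  have hbr : Orthonormal ℝ fun j => b (.inr j) := b.orthonormal.comp _ Sum.inr_injective
  -- Parseval
  have hsq : ∀ {k : ℕ} {v : Fin k → EuclideanSpace ℝ (Fin n)} (_ : Orthonormal ℝ v)
      (a : Fin k → ℝ), ‖∑ i, a i • v i‖ ^ 2 = ∑ i, a i ^ 2 := by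
    intro k v hv a
    rw [← real_inner_self_eq_norm_sq, hv.inner_sum]
    simp [pow_two]
  have hnum : ∑ i : Fin p, (σ * z i + if i = ⟨0, hp⟩ then c else 0) ^ 2 =
      σ ^ 2 * shiftedSqSum (c / σ) p z := by
    have : ∀ i : Fin p, (σ * z i + if i = ⟨0, hp⟩ then c else 0) ^ 2 =
        σ ^ 2 * z i ^ 2 + if i = ⟨0, hp⟩ then 2 * σ * c * z i + c ^ 2 else 0 := by
      intro i
      split_ifs <;> ring
    simp only [this, Finset.sum_add_distrib, Finset.sum_ite_eq', Finset.mem_univ, if_true,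
      shiftedSqSum, sqSum, Finset.sum_range, ← Finset.mul_sum]
    field_simp
    ring
  have hden : ∑ j : Fin m, (σ * w j) ^ 2 = σ ^ 2 * sqSum m w := by
    simp [sqSum, Finset.sum_range, mul_pow, Finset.mul_sum]
  rw [fStatistic, hproj, hres, hsq hbl, hsq hbr, hnum, hden, fRatio]
  have : (n : ℝ) - p = m := by rw [hn]; push_cast; ring
  rw [this, mul_div_assoc, mul_div_assoc (σ ^ 2) (sqSum m w), mul_div_mul_left _ _ (by positivity)]

@[fun_prop]
lemma measurable_sumElim_seq (p m : ℕ) : Measurable fun ω : (ℕ → ℝ) × (ℕ → ℝ) =>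
    (Sum.elim (fun i : Fin p => ω.1 i) (fun j : Fin m => ω.2 j) : Fin p ⊕ Fin m → ℝ) := by
  refine measurable_pi_iff.2 ?_
  rintro (i | j) <;> simp only [Sum.elim_inl, Sum.elim_inr] <;> fun_prop

lemma map_gaussianSeqPair_sum (p m : ℕ) :
    gaussianSeqPair.map (fun ω => Sum.elim (fun i : Fin p => ω.1 i) (fun j : Fin m => ω.2 j)) =
      Measure.pi fun _ => gaussianReal 0 1 := by
  have h := (measurePreserving_sumPiEquivProdPi_symm
    (fun _ : Fin p ⊕ Fin m => gaussianReal 0 1)).map_eq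
  rw [← h, ← map_gaussianSeq_fin p, ← map_gaussianSeq_fin m,
    Measure.map_prod_map _ _ (by fun_prop) (by fun_prop),
    Measure.map_map (by fun_prop) (by fun_prop)]
  rfl

/-- The power depends on `X` and `β` only through the dimensions and `‖X β‖ / σ`. -/
theorem fTestPower_eq {n p : ℕ} (X : Matrix (Fin n) (Fin p) ℝ) (β : EuclideanSpace ℝ (Fin p))
    (α : ℝ) {σ : ℝ} (hσ : 0 < σ) (hp : 0 < p) (hpn : p ≤ n) (hX : X.rank = p) :
    fTestPower α σ X β = gaussianSeqPair.real
      {ω | lawQuantile (gaussianSeqPair.map (fRatio 0 p (n - p))) (1 - α) <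
        fRatio (‖regressionMean X β‖ / σ) p (n - p) ω} := by
  obtain ⟨m, hm⟩ : ∃ m, n = p + m := ⟨n - p, by omega⟩
  have hnp : n - p = m := by omega
  have hrank : Module.finrank ℝ (columnSpace X) = p := by
    refine Eq.trans ?_ hX
    rw [Matrix.rank_eq_finrank_range_toLin X (EuclideanSpace.basisFun _ ℝ).toBasis
      (EuclideanSpace.basisFun _ ℝ).toBasis]
    rfl
  obtain ⟨b, hb, hb', hu⟩ := exists_adapted_orthonormalBasis (m := m) hp hrank (by simpa using hm)
    (show regressionMean X β ∈ columnSpace X from ⟨β, rfl⟩)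
  rw [fTestPower, gaussianLinearModel_eq_map X β hσ, stdGaussian_eq_map_pi_orthonormalBasis b,
    ← map_gaussianSeqPair_sum, Measure.map_map (by fun_prop) (by fun_prop),
    Measure.map_map (by fun_prop) (by fun_prop), fTestRejectionRegion, hnp,
    fDistribution_eq_map_fRatio, map_measureReal_apply (by fun_prop)]
  · congr 1
    ext ω
    simp only [Function.comp, Set.mem_preimage, Set.mem_ofPred_eq]
    rw [← fStatistic_eq X hm hp b hb hb' hσ ω.1 ω.2, ← hu]
  · refine measurableSet_lt measurable_const ?_
    unfold fStatistic
    fun_prop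

/-! ### The central limit theorem for the `F`-ratio -/

lemma map_eval_gaussianSeq (i : ℕ) : gaussianSeq.map (fun z => z i) = gaussianReal 0 1 :=
  Measure.infinitePi_map_eval _ i

lemma identDistrib_sq_gaussianSeq (i : ℕ) :
    IdentDistrib (fun z : ℕ → ℝ => z i ^ 2) (fun z => z 0 ^ 2) gaussianSeq gaussianSeq := by
  have h : IdentDistrib (fun z : ℕ → ℝ => z i) (fun z => z 0) gaussianSeq gaussianSeq :=
    ⟨(measurable_pi_apply i).aemeasurable, (measurable_pi_apply 0).aemeasurable,
      by rw [map_eval_gaussianSeq, map_eval_gaussianSeq]⟩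
  exact h.comp (u := fun x : ℝ => x ^ 2) (by fun_prop)

lemma iIndepFun_sq_gaussianSeq : iIndepFun (fun i (z : ℕ → ℝ) => z i ^ 2) gaussianSeq :=
  iIndepFun_infinitePi (X := fun _ (x : ℝ) => x ^ 2) (fun _ => by fun_prop)

lemma integral_sq_gaussianSeq : ∫ z, z 0 ^ 2 ∂gaussianSeq = 1 := by
  have h : ∫ x, x ^ 2 ∂(gaussianReal 0 1) = 1 := by
    have h1 := variance_fun_id_gaussianReal (μ := 0) (v := 1)
    rw [variance_eq_integral (by fun_prop)] at h1
    simpa [integral_id_gaussianReal] using h1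
  rw [← map_eval_gaussianSeq 0, integral_map (measurable_pi_apply 0).aemeasurable (by fun_prop)] at h
  exact h

lemma memLp_sq_gaussianSeq : MemLp (fun z : ℕ → ℝ => z 0 ^ 2) 2 gaussianSeq := by
  have h : MemLp (fun x : ℝ => x ^ 2) 2 (gaussianReal 0 1) := by
    -- Hölder's inequality with `1/4 + 1/4 = 1/2`
    have h4 : MemLp (id : ℝ → ℝ) 4 (gaussianReal 0 1) := memLp_id_gaussianReal' 4 (by simp)
    have : ENNReal.HolderTriple 4 4 2 := ⟨by
      rw [← ENNReal.toReal_eq_toReal_iff' (by simp) (by simp),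
        ENNReal.toReal_add (by simp) (by simp)]
      norm_num⟩
    have := h4.mul (r := 2) h4
    simpa [pow_two] using! this
  rw [← map_eval_gaussianSeq 0] at h
  exact h.comp_of_map (measurable_pi_apply 0).aemeasurable

/-- The variance of the square of a standard normal variable. Its value `2` plays no role, only its
positivity does. -/
noncomputable def varSq : ℝ≥0 := Var[fun z : ℕ → ℝ => z 0 ^ 2; gaussianSeq].toNNReal

lemma varSq_pos : 0 < varSq := by
  rw [varSq, Real.toNNReal_pos]
  refine lt_of_le_of_ne (variance_nonneg _ _) fun h => ?_
  have h1 := ae_eq_integral_of_variance_eq_zero memLp_sq_gaussianSeq h.symm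
  rw [integral_sq_gaussianSeq] at h1
  have h2 : ∀ᵐ x ∂(gaussianReal 0 1), x ^ 2 = 1 := by
    rw [← map_eval_gaussianSeq 0, ae_map_iff (f := fun z : ℕ → ℝ => z 0)
      (measurable_pi_apply 0).aemeasurable (measurableSet_eq_fun (by fun_prop) (by fun_prop))]
    exact h1
  have := (gaussianReal_absolutelyContinuous' 0 one_ne_zero).isOpenPosMeasure
  have h3 := (isOpen_Ioo (a := (-1 : ℝ)) (b := 1)).measure_pos (gaussianReal 0 1) ⟨0, by simp⟩
  refine h3.ne' (measure_mono_null (fun x hx => ?_) (ae_iff.1 h2))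
  have : x ^ 2 < 1 := by nlinarith [hx.1, hx.2]
  exact this.ne

/-- The centred and rescaled sum of squares to which the central limit theorem applies. -/
noncomputable def stdSqSum (k : ℕ) (z : ℕ → ℝ) : ℝ := (√k)⁻¹ * (sqSum k z - k)

@[fun_prop]
lemma measurable_stdSqSum (k : ℕ) : Measurable (stdSqSum k) := by
  unfold stdSqSum; fun_prop

lemma tendstoInDistribution_stdSqSum :
    TendstoInDistribution stdSqSum atTop id (fun _ => gaussianSeq) (gaussianReal 0 varSq) := by
  have hlaw : HasLaw id (gaussianReal 0 varSq) (gaussianReal 0 varSq) := .id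
  rw [varSq] at hlaw
  have h := tendstoInDistribution_inv_sqrt_mul_sum_sub (X := fun i (z : ℕ → ℝ) => z i ^ 2) hlaw
    memLp_sq_gaussianSeq iIndepFun_sq_gaussianSeq identDistrib_sq_gaussianSeq
  simp only [integral_sq_gaussianSeq, mul_one] at h
  exact h

lemma ae_tendsto_sqSum_div :
    ∀ᵐ z ∂gaussianSeq, Tendsto (fun k : ℕ => sqSum k z / k) atTop (𝓝 1) := by
  have h := strong_law_ae_real (fun i (z : ℕ → ℝ) => z i ^ 2)
    (memLp_sq_gaussianSeq.integrable (by norm_num))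
    (fun i j hij => iIndepFun_sq_gaussianSeq.indepFun hij) identDistrib_sq_gaussianSeq
  rwa [integral_sq_gaussianSeq] at h

lemma ae_tendsto_sqSum_div_snd {m : ℕ → ℕ} (hm : Tendsto m atTop atTop) :
    ∀ᵐ ω ∂gaussianSeqPair, Tendsto (fun n => sqSum (m n) ω.2 / m n) atTop (𝓝 1) := by
  have h : ∀ᵐ ω ∂gaussianSeqPair, Tendsto (fun k : ℕ => sqSum k ω.2 / k) atTop (𝓝 1) :=
    Measure.quasiMeasurePreserving_snd.ae ae_tendsto_sqSum_div
  filter_upwards [h] with ω hω using hω.comp hm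

/-- Convergence in distribution of two sequences on the two factors of a product space is joint. -/
lemma MeasureTheory.TendstoInDistribution.prodMap {Ω₁ Ω₂ : Type*} [MeasurableSpace Ω₁]
    [MeasurableSpace Ω₂] {P₁ : Measure Ω₁} {P₂ : Measure Ω₂} [IsProbabilityMeasure P₁]
    [IsProbabilityMeasure P₂] {μ₁ μ₂ : Measure ℝ} [IsProbabilityMeasure μ₁]
    [IsProbabilityMeasure μ₂] {X : ℕ → Ω₁ → ℝ} {Y : ℕ → Ω₂ → ℝ} {l : Filter ℕ}
    (hXm : ∀ n, Measurable (X n)) (hYm : ∀ n, Measurable (Y n))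
    (hX : TendstoInDistribution X l id (fun _ => P₁) μ₁)
    (hY : TendstoInDistribution Y l id (fun _ => P₂) μ₂) :
    TendstoInDistribution (fun n (ω : Ω₁ × Ω₂) => (X n ω.1, Y n ω.2)) l id
      (fun _ => P₁.prod P₂) (μ₁.prod μ₂) where
  forall_aemeasurable n := (((hXm n).comp measurable_fst).prodMk
    ((hYm n).comp measurable_snd)).aemeasurable
  tendsto := by
    have h := (ProbabilityMeasure.continuous_prod.tendsto _).comp
      (hX.tendsto.prodMk_nhds hY.tendsto)
    have e1 : ∀ n, (P₁.prod P₂).map (fun ω : Ω₁ × Ω₂ => (X n ω.1, Y n ω.2)) =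
        (P₁.map (X n)).prod (P₂.map (Y n)) := fun n =>
      (Measure.map_prod_map _ _ (hXm n) (hYm n)).symm
    have e2 : (μ₁.prod μ₂).map id = (μ₁.map id).prod (μ₂.map id) := by simp
    exact (h.congr fun n => Subtype.ext (e1 n).symm).mono_right
      (le_of_eq (congrArg 𝓝 (Subtype.ext e2.symm)))

lemma tendstoInDistribution_stdSqSum_pair {p m : ℕ → ℕ} (hp : Tendsto p atTop atTop)
    (hm : Tendsto m atTop atTop) :
    TendstoInDistribution (fun n (ω : (ℕ → ℝ) × (ℕ → ℝ)) =>
      (stdSqSum (p n) ω.1, stdSqSum (m n) ω.2)) atTop id (fun _ => gaussianSeqPair)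
      ((gaussianReal 0 varSq).prod (gaussianReal 0 varSq)) := by
  have h : ∀ {r : ℕ → ℕ}, Tendsto r atTop atTop → TendstoInDistribution (fun n => stdSqSum (r n))
      atTop id (fun _ => gaussianSeq) (gaussianReal 0 varSq) := fun hr =>
    ⟨fun n => by fun_prop, by fun_prop, tendstoInDistribution_stdSqSum.tendsto.comp hr⟩
  exact TendstoInDistribution.prodMap (fun n => by fun_prop) (fun n => by fun_prop) (h hp) (h hm)

lemma map_linear_prod_gaussianReal (a b d : ℝ) (v : ℝ≥0) :
    ((gaussianReal 0 v).prod (gaussianReal 0 v)).map (fun x => a * x.1 - b * x.2 + d) =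
      gaussianReal d (NNReal.mk (a ^ 2) (sq_nonneg a) * v + NNReal.mk (b ^ 2) (sq_nonneg b) * v) := by
  have h1 : ((gaussianReal 0 v).prod (gaussianReal 0 v)).map (fun x => a * x.1 + d) =
      gaussianReal d (NNReal.mk (a ^ 2) (sq_nonneg a) * v) := by
    have : (fun x : ℝ × ℝ => a * x.1 + d) = (· + d) ∘ (a * ·) ∘ Prod.fst := rfl
    rw [this, ← Measure.map_map (by fun_prop) (by fun_prop),
      ← Measure.map_map (by fun_prop) (by fun_prop), Measure.map_fst_prod, measure_univ, one_smul,
      gaussianReal_map_const_mul, gaussianReal_map_add_const]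
    simp
  have h2 : ((gaussianReal 0 v).prod (gaussianReal 0 v)).map (fun x => (-b) * x.2) =
      gaussianReal 0 (NNReal.mk (b ^ 2) (sq_nonneg b) * v) := by
    have : (fun x : ℝ × ℝ => (-b) * x.2) = ((-b) * ·) ∘ Prod.snd := rfl
    rw [this, ← Measure.map_map (by fun_prop) (by fun_prop), Measure.map_snd_prod, measure_univ,
      one_smul, gaussianReal_map_const_mul]
    simp
  have h3 := gaussianReal_add_gaussianReal_of_indepFun
    (indepFun_prod (μ := gaussianReal 0 v) (ν := gaussianReal 0 v) (X := fun x => a * x + d)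
      (Y := fun x => (-b) * x) (by fun_prop) (by fun_prop)) h1 h2
  rw [add_zero] at h3
  rw [← h3]
  congr 1
  ext x
  simp only [Pi.add_apply]
  ring

/-- The fluctuation of the `F`-ratio around `1`. The last term vanishes unless the denominator is
zero, where Lean divides by zero; keeping it makes the identity hold everywhere. -/
lemma fRatio_fluctuation {δ : ℝ} {p m : ℕ} (hp : 0 < p) (hm : 0 < m) (s : ℝ)
    (ω : (ℕ → ℝ) × (ℕ → ℝ)) :
    s * (fRatio δ p m ω - 1) =
      (s / √p * stdSqSum p ω.1 - s / √m * stdSqSum m ω.2 + s / p * (2 * δ * ω.1 0 + δ ^ 2)) *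
        (sqSum m ω.2 / m)⁻¹ + s * (sqSum m ω.2 / m * (sqSum m ω.2 / m)⁻¹ - 1) := by
  have h : ∀ {k : ℕ} (_ : 0 < k) (z : ℕ → ℝ), s / √k * stdSqSum k z = s * (sqSum k z / k - 1) := by
    intro k hk z
    have hk' : (0 : ℝ) < k := by exact_mod_cast hk
    have : (√(k : ℝ))⁻¹ * (√(k : ℝ))⁻¹ = (k : ℝ)⁻¹ := by
      rw [← mul_inv, Real.mul_self_sqrt hk'.le]
    rw [stdSqSum, div_eq_mul_inv, mul_assoc, ← mul_assoc (√(k : ℝ))⁻¹, this]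
    field_simp
  rw [h hp, h hm, fRatio, shiftedSqSum, div_eq_mul_inv _ (sqSum m ω.2 / m)]
  ring

/-- Asymptotic normality of `√n (F - 1)` when both degrees of freedom are of order `n`, with a mean
shift `d` from the noncentrality. -/
lemma tendsto_cdf_fRatio {p m : ℕ → ℕ} (hp : Tendsto p atTop atTop) (hm : Tendsto m atTop atTop)
    {a b d : ℝ} (ha : Tendsto (fun n : ℕ => √n / √(p n)) atTop (𝓝 a))
    (hb : Tendsto (fun n : ℕ => √n / √(m n)) atTop (𝓝 b)) (hapos : 0 < a) {δ : ℕ → ℝ}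
    (hδ : Tendsto (fun n : ℕ => √n / p n * δ n) atTop (𝓝 0))
    (hδ2 : Tendsto (fun n : ℕ => √n / p n * δ n ^ 2) atTop (𝓝 d)) (x : ℝ) :
    Tendsto (fun n : ℕ => gaussianSeqPair.real {ω | √n * (fRatio (δ n) (p n) (m n) ω - 1) ≤ x})
      atTop (𝓝 ((gaussianReal d (NNReal.mk (a ^ 2) (sq_nonneg a) * varSq +
        NNReal.mk (b ^ 2) (sq_nonneg b) * varSq)).real (Set.Iic x))) := by
  -- all the factors in `fRatio_fluctuation` that have a deterministic limit
  set Y : ℕ → (ℕ → ℝ) × (ℕ → ℝ) → ℝ × ℝ × ℝ × ℝ × ℝ := fun n ω =>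
    (√n / √(p n), √n / √(m n), √n / p n * (2 * δ n * ω.1 0 + δ n ^ 2),
      (sqSum (m n) ω.2 / m n)⁻¹,
      √n * (sqSum (m n) ω.2 / m n * (sqSum (m n) ω.2 / m n)⁻¹ - 1)) with hYdef
  have hYm : ∀ n, Measurable (Y n) := fun n => by simp only [hYdef]; fun_prop
  have hYlim : ∀ᵐ ω ∂gaussianSeqPair, Tendsto (fun n => Y n ω) atTop (𝓝 (a, b, d, 1, 0)) := by
    filter_upwards [ae_tendsto_sqSum_div_snd hm] with ω hω
    refine ha.prodMk_nhds (hb.prodMk_nhds (Tendsto.prodMk_nhds ?_ (Tendsto.prodMk_nhds ?_ ?_)))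
    · have := (hδ.mul_const (2 * ω.1 0)).add hδ2
      rw [zero_mul, zero_add] at this
      exact this.congr fun n => by ring
    · simpa using hω.inv₀ one_ne_zero
    · refine tendsto_const_nhds.congr' ?_
      filter_upwards [hω.eventually_ne one_ne_zero] with n hn
      rw [mul_inv_cancel₀ hn, sub_self, mul_zero]
  have hY := tendstoInMeasure_of_tendsto_ae (fun n => (hYm n).aestronglyMeasurable) hYlim
  have h := TendstoInDistribution.continuous_comp_prodMk_of_tendstoInMeasure_const
    (g := fun u : (ℝ × ℝ) × ℝ × ℝ × ℝ × ℝ × ℝ =>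
      (u.2.1 * u.1.1 - u.2.2.1 * u.1.2 + u.2.2.2.1) * u.2.2.2.2.1 + u.2.2.2.2.2)
    (by fun_prop) (tendstoInDistribution_stdSqSum_pair hp hm) hY
    (fun n => (hYm n).aemeasurable)
  simp only [id, mul_one, add_zero] at h
  have hlaw := map_linear_prod_gaussianReal a b d varSq
  set V : ℝ≥0 := NNReal.mk (a ^ 2) (sq_nonneg a) * varSq +
    NNReal.mk (b ^ 2) (sq_nonneg b) * varSq with hV
  have hV0 : V ≠ 0 := by
    have : (0 : ℝ≥0) < NNReal.mk (a ^ 2) (sq_nonneg a) * varSq :=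
      mul_pos (by exact_mod_cast pow_pos hapos 2) varSq_pos
    exact (add_pos_of_pos_of_nonneg this zero_le).ne'
  have hna := nullSingletonClass_gaussianReal (μ := d) hV0
  have hfin := tendsto_cdf_of_tendstoInDistribution h x (by
    have : gaussianReal d V {x} = 0 := measure_singleton x
    rwa [← hlaw, Measure.map_apply (by fun_prop) (by simp)] at this)
  rw [← hlaw, map_measureReal_apply (by fun_prop) measurableSet_Iic]
  -- for `p = 0` or `m = 0` the identity `fRatio_fluctuation` fails
  refine hfin.congr' ?_
  filter_upwards [hp.eventually_gt_atTop 0, hm.eventually_gt_atTop 0] with n hpn hmn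
  simp only [fRatio_fluctuation hpn hmn, hYdef]

/-! ### Shifted sums of squares -/

/-- Moving a centred interval off the origin strictly decreases its Gaussian mass: the derivative
of the mass in the shift `t` is `φ(r + t) - φ(r - t) < 0`. -/
lemma measureReal_Icc_shift_lt {δ r : ℝ} (hδ : 0 < δ) (hr : 0 < r) :
    (gaussianReal 0 1).real (Set.Icc (-r - δ) (r - δ)) < (gaussianReal 0 1).real (Set.Icc (-r) r) := by
  have hint : ∀ a b : ℝ, a ≤ b → (gaussianReal 0 1).real (Set.Icc a b) =
      (∫ x in (0)..b, gaussianPDFReal 0 1 x) - ∫ x in (0)..a, gaussianPDFReal 0 1 x := by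
    intro a b hab
    have hi : ∀ c d, IntervalIntegrable (gaussianPDFReal 0 1) volume c d := fun c d =>
      (integrable_gaussianPDFReal 0 1).intervalIntegrable
    rw [measureReal_def, gaussianReal_apply_eq_integral 0 one_ne_zero, ENNReal.toReal_ofReal
      (integral_nonneg fun x => gaussianPDFReal_nonneg 0 1 x), integral_Icc_eq_integral_Ioc,
      ← intervalIntegral.integral_of_le hab,
      intervalIntegral.integral_interval_sub_left (hi _ _) (hi _ _)]
  have hcont : Continuous (gaussianPDFReal 0 1) := by
    unfold gaussianPDFReal; fun_prop
  have hΦ : ∀ x, HasDerivAt (fun u => ∫ x in (0)..u, gaussianPDFReal 0 1 x)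
      (gaussianPDFReal 0 1 x) x := fun x =>
    intervalIntegral.integral_hasDerivAt_right (hcont.intervalIntegrable _ _)
      (hcont.stronglyMeasurableAtFilter _ _) hcont.continuousAt
  have hd : ∀ t, HasDerivAt (fun t => (∫ x in (0)..(r - t), gaussianPDFReal 0 1 x) -
      ∫ x in (0)..(-r - t), gaussianPDFReal 0 1 x)
      (gaussianPDFReal 0 1 (r - t) * (-1) - gaussianPDFReal 0 1 (-r - t) * (-1)) t := by
    intro t
    exact ((hΦ _).comp t ((hasDerivAt_id t).const_sub r)).sub
      ((hΦ _).comp t ((hasDerivAt_id t).const_sub (-r)))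
  have hanti := strictAntiOn_of_deriv_neg (convex_Ici (0 : ℝ))
    (fun t _ => (hd t).continuousAt.continuousWithinAt) (fun t ht => by
      rw [interior_Ici] at ht
      rw [(hd t).deriv]
      have : gaussianPDFReal 0 1 (-r - t) < gaussianPDFReal 0 1 (r - t) := by
        simp only [gaussianPDFReal]
        gcongr ?_ * Real.exp ?_
        · simp
          nlinarith [mul_pos hr ht]
      linarith)
  have := hanti (Set.mem_Ici.2 le_rfl) (Set.mem_Ici.2 hδ.le) hδ
  simp only [sub_zero] at this
  rwa [hint _ _ (by linarith), hint _ _ (by linarith)]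

lemma measure_sq_add_le_lt {δ s : ℝ} (hδ : 0 < δ) (hs : 0 < s) :
    gaussianReal 0 1 {x | (x + δ) ^ 2 ≤ s} < gaussianReal 0 1 {x | x ^ 2 ≤ s} := by
  have h := measureReal_Icc_shift_lt hδ (Real.sqrt_pos.2 hs)
  have h1 : ∀ t : ℝ, {x : ℝ | (x + t) ^ 2 ≤ s} = Set.Icc (-√s - t) (√s - t) := by
    intro t
    ext x
    simp only [Set.mem_ofPred_eq, Set.mem_Icc, Real.sq_le hs.le]
    constructor <;> rintro ⟨_, _⟩ <;> constructor <;> linarith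
  have h2 := h1 0
  simp only [add_zero, sub_zero] at h2
  rw [h1, h2]
  exact (ENNReal.toReal_lt_toReal (measure_ne_top _ _) (measure_ne_top _ _)).1 h

lemma measure_sq_add_eq (δ s : ℝ) : gaussianReal 0 1 {x | (x + δ) ^ 2 = s} = 0 := by
  have := nullSingletonClass_gaussianReal (μ := 0) one_ne_zero
  refine measure_mono_null (t := {√s - δ, -√s - δ}) (fun x hx => ?_)
    (Set.Finite.measure_zero (by simp) _)
  have hx' : (x + δ) ^ 2 = s := hx
  have : |x + δ| = √s := by rw [← hx', Real.sqrt_sq_eq_abs]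
  rcases abs_choice (x + δ) with h | h <;> simp <;> grind

instance : gaussianSeq.IsOpenPosMeasure := by
  refine ⟨fun U hU hne => ?_⟩
  obtain ⟨f, hf⟩ := hne
  obtain ⟨I, u, hu, hsub⟩ := isOpen_pi_iff.1 hU f hf
  have := (gaussianReal_absolutelyContinuous' 0 one_ne_zero).isOpenPosMeasure
  have h1 : 0 < gaussianSeq ((I : Set ℕ).pi u) := by
    rw [gaussianSeq, Measure.infinitePi_pi _ fun i hi => (hu i hi).1.measurableSet]
    exact pos_iff_ne_zero.2 (Finset.prod_ne_zero_iff.2 fun i hi =>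
      ((hu i hi).1.measure_pos _ ⟨_, (hu i hi).2⟩).ne')
  exact (h1.trans_le (measure_mono hsub)).ne'

/-- Disintegration over the sum `t` of the squares with positive index, whose law `μ` is independent
of the first coordinate and charges every neighbourhood of `0` in `[0, ∞)`. -/
lemma exists_law_shiftedSqSum {k : ℕ} (hk : 0 < k) :
    ∃ μ : Measure ℝ, IsProbabilityMeasure μ ∧ (∀ r, 0 < r → 0 < μ (Set.Iio r)) ∧
      ∀ (δ : ℝ) (s : Set ℝ), MeasurableSet s → gaussianSeq (shiftedSqSum δ k ⁻¹' s) =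
        ∫⁻ t, gaussianReal 0 1 {x | (x + δ) ^ 2 + t ∈ s} ∂μ := by
  set T : (ℕ → ℝ) → ℝ := fun z => ∑ i ∈ Finset.Ico 1 k, z i ^ 2 with hT
  have hTc : Continuous T := by fun_prop
  have hTm : Measurable T := hTc.measurable
  refine ⟨gaussianSeq.map T, Measure.isProbabilityMeasure_map hTm.aemeasurable, fun r hr => ?_,
    fun δ s hs => ?_⟩
  · rw [Measure.map_apply hTm measurableSet_Iio]
    exact (isOpen_Iio.preimage hTc).measure_pos _ ⟨0, by simpa [hT]⟩
  · have hind : IndepFun (fun z : ℕ → ℝ => z 0) T gaussianSeq := by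
      have h0 : iIndepFun (fun (i : ℕ) (z : ℕ → ℝ) => z i) gaussianSeq :=
        iIndepFun_infinitePi (X := fun _ (x : ℝ) => x) fun _ => by fun_prop
      have h1 := h0.indepFun_finset {0} (Finset.Ico 1 k) (by simp) fun i => by fun_prop
      have hφ : Measurable fun u : ({0} : Finset ℕ) → ℝ => u ⟨0, by simp⟩ := measurable_pi_apply _
      have hψ : Measurable fun u : Finset.Ico 1 k → ℝ => ∑ i, u i ^ 2 := by fun_prop
      have h2 := h1.comp hφ hψ
      convert! h2 using 1
      ext z
      simp only [hT, Function.comp]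
      exact (Finset.sum_coe_sort (Finset.Ico 1 k) fun i => z i ^ 2).symm
    have hjoint := (indepFun_iff_map_prod_eq_prod_map_map (measurable_pi_apply 0).aemeasurable
      hTm.aemeasurable).1 hind
    rw [show gaussianSeq.map (fun z => z 0) = gaussianReal 0 1 from
      Measure.infinitePi_map_eval _ 0] at hjoint
    have hfac : shiftedSqSum δ k ⁻¹' s =
        (fun z => (z 0, T z)) ⁻¹' {w : ℝ × ℝ | (w.1 + δ) ^ 2 + w.2 ∈ s} := by
      ext z
      have : shiftedSqSum δ k z = (z 0 + δ) ^ 2 + T z := by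
        rw [shiftedSqSum, sqSum, Finset.range_eq_Ico, Finset.sum_eq_sum_Ico_succ_bot hk, hT]
        ring
      simp [this]
    have hms : MeasurableSet {w : ℝ × ℝ | (w.1 + δ) ^ 2 + w.2 ∈ s} :=
      (by fun_prop : Measurable fun w : ℝ × ℝ => (w.1 + δ) ^ 2 + w.2) hs
    rw [hfac, ← Measure.map_apply (by fun_prop) hms, hjoint, Measure.prod_apply_symm hms]
    rfl

lemma measure_shiftedSqSum_eq {k : ℕ} (hk : 0 < k) (δ c : ℝ) :
    gaussianSeq {z | shiftedSqSum δ k z = c} = 0 := by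
  obtain ⟨μ, -, -, h⟩ := exists_law_shiftedSqSum hk
  refine (h δ {c} (by simp)).trans ?_
  simp [← eq_sub_iff_add_eq, measure_sq_add_eq]

/-- The noncentral chi-squared law puts strictly less mass near `0` than the central one. -/
lemma measure_shiftedSqSum_le_lt {k : ℕ} (hk : 0 < k) {δ R : ℝ} (hδ : 0 < δ) (hR : 0 < R) :
    gaussianSeq {z | shiftedSqSum δ k z ≤ R} < gaussianSeq {z | sqSum k z ≤ R} := by
  obtain ⟨μ, hμ, hpos, h⟩ := exists_law_shiftedSqSum hk
  have h0 := h 0 (Set.Iic R) measurableSet_Iic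
  have h1 := h δ (Set.Iic R) measurableSet_Iic
  simp only [Set.mem_Iic, ← le_sub_iff_add_le, add_zero] at h0 h1
  have e0 : {z | sqSum k z ≤ R} = shiftedSqSum 0 k ⁻¹' Set.Iic R := by
    ext z; simp [shiftedSqSum_zero]
  rw [e0, show {z | shiftedSqSum δ k z ≤ R} = shiftedSqSum δ k ⁻¹' Set.Iic R from rfl, h0, h1]
  refine lintegral_strict_mono_of_ae_le_of_ae_lt_on (s := Set.Iio R) ?_ ?_ ?_ (hpos R hR).ne' ?_
  · have : MeasurableSet {w : ℝ × ℝ | w.1 ^ 2 ≤ R - w.2} :=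
      measurableSet_le (by fun_prop) (by fun_prop)
    exact (measurable_measure_prodMk_right this).aemeasurable
  · rw [← h1]; exact measure_ne_top _ _
  · refine ae_of_all _ fun t => ?_
    rcases lt_or_ge t R with ht | ht
    · exact (measure_sq_add_le_lt hδ (sub_pos.2 ht)).le
    -- for `t ≥ R` the left event is contained in `{-δ}`, a null set
    · refine le_of_eq_of_le ?_ zero_le
      refine measure_mono_null (fun x hx => ?_) (measure_sq_add_eq δ 0)
      have hx' : (x + δ) ^ 2 ≤ R - t := hx
      exact le_antisymm (by linarith) (sq_nonneg _)
  · exact ae_of_all _ fun t ht => measure_sq_add_le_lt hδ (sub_pos.2 ht)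

/-! ### Limits of the power -/

lemma gaussianSeqPair_real_fst {A : Set (ℕ → ℝ)} (hA : MeasurableSet A) :
    gaussianSeqPair.real {ω | ω.1 ∈ A} = gaussianSeq.real A :=
  (measurePreserving_fst (μ := gaussianSeq) (ν := gaussianSeq)).measureReal_preimage
    hA.nullMeasurableSet

lemma tendsto_cdf_fRatio_fixed {p : ℕ} (hp : 0 < p) (δ x : ℝ) :
    Tendsto (fun n : ℕ => gaussianSeqPair.real {ω | fRatio δ p (n - p) ω ≤ x}) atTop
      (𝓝 (gaussianSeq.real {z | shiftedSqSum δ p z / p ≤ x})) := by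
  have hp' : (0 : ℝ) < p := by exact_mod_cast hp
  have hlim : TendstoInDistribution (fun n : ℕ => fRatio δ p (n - p)) atTop
      (fun ω => shiftedSqSum δ p ω.1 / p) (fun _ => gaussianSeqPair) gaussianSeqPair := by
    refine tendstoInDistribution_of_ae_tendsto (fun n => by fun_prop) (by fun_prop) ?_
    filter_upwards [ae_tendsto_sqSum_div_snd (tendsto_sub_atTop_nat p)] with ω hω
    have h := (tendsto_const_nhds (x := shiftedSqSum δ p ω.1 / p)).div hω one_ne_zero
    rwa [div_one] at h
  have h := tendsto_cdf_of_tendstoInDistribution hlim x (by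
    refine Measure.quasiMeasurePreserving_fst.preimage_null
      (s := {z | shiftedSqSum δ p z / p = x}) ?_
    simpa only [div_eq_iff hp'.ne'] using measure_shiftedSqSum_eq hp δ (x * p))
  rw [← gaussianSeqPair_real_fst (measurableSet_le (by fun_prop) (by fun_prop))]
  exact h

lemma sqSum_single {k : ℕ} (hk : 0 < k) (r : ℝ) : sqSum k (Pi.single 0 r) = r ^ 2 := by
  rw [sqSum, Finset.sum_eq_single_of_mem 0 (by simpa using hk)]
  · simp
  · intro i _ hi
    simp [hi]

/-- The law of `‖z‖² / k` charges every interval `(x, y]` with `y > 0`. -/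
lemma measure_sqSum_div_Ioc_pos {k : ℕ} (hk : 0 < k) {x y : ℝ} (hxy : x < y)
    (hy : 0 < gaussianSeq {z | sqSum k z / k ≤ y}) :
    0 < gaussianSeq {z | x < sqSum k z / k ∧ sqSum k z / k ≤ y} := by
  have hk' : (0 : ℝ) < k := by exact_mod_cast hk
  have hy0 : 0 < y := by
    by_contra! hy0
    refine hy.ne' (measure_mono_null (fun z hz => ?_) (measure_shiftedSqSum_eq hk 0 0))
    have hz' : sqSum k z / k ≤ y := hz
    rw [div_le_iff₀ hk'] at hz'
    have h0 : 0 ≤ sqSum k z := Finset.sum_nonneg fun i _ => sq_nonneg _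
    have : sqSum k z = 0 := le_antisymm (by nlinarith) h0
    simpa [shiftedSqSum_zero] using this
  obtain ⟨r, hr, hry⟩ := exists_between (max_lt hxy hy0)
  have hr0 : 0 < r := (le_max_right _ _).trans_lt hr
  have hopen : IsOpen {z : ℕ → ℝ | x < sqSum k z / k ∧ sqSum k z / k < y} :=
    isOpen_Ioo.preimage (by fun_prop : Continuous fun z : ℕ → ℝ => sqSum k z / k)
  refine (hopen.measure_pos gaussianSeq ⟨Pi.single 0 (√(r * k)), ?_⟩).trans_le
    (measure_mono fun z hz => ⟨hz.1, hz.2.le⟩)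
  simp only [Set.mem_ofPred_eq]
  rw [sqSum_single hk, Real.sq_sqrt (by positivity), mul_div_cancel_right₀ _ hk'.ne']
  exact ⟨(le_max_left _ _).trans_lt hr, hry⟩

/-- The power converges to a limit in `(α, 1)` when the number of predictors and the signal strength
are fixed. -/
theorem exists_tendsto_fTestPower_fixed {α σ : ℝ} (hα : 0 < α) (hα' : α < 1) (hσ : 0 < σ) {p₀ : ℕ}
    {c₀ : ℝ} (hp : 1 ≤ p₀) (hc : 0 < c₀) (X : (n : ℕ) → Matrix (Fin n) (Fin p₀) ℝ)
    (β : ℕ → EuclideanSpace ℝ (Fin p₀)) (hX : ∀ᶠ n in atTop, (X n).rank = p₀)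
    (hβ : ∀ᶠ n in atTop, ‖regressionMean (X n) (β n)‖ = c₀) :
    ∃ L, α < L ∧ L < 1 ∧ Tendsto (fun n => fTestPower α σ (X n) (β n)) atTop (𝓝 L) := by
  have hp' : (0 : ℝ) < p₀ := by exact_mod_cast hp
  have hδ : 0 < c₀ / σ := div_pos hc hσ
  have hatom : ∀ δ x, gaussianSeq {z | shiftedSqSum δ p₀ z / p₀ = x} = 0 := fun δ x => by
    simpa only [div_eq_iff hp'.ne'] using measure_shiftedSqSum_eq hp δ (x * p₀)
  obtain ⟨q, hq, hlt, hgt⟩ := exists_isolated_quantile (P := gaussianSeq)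
    (Y := fun z => sqSum p₀ z / p₀) (by fun_prop)
    (by simpa only [shiftedSqSum_zero] using hatom 0)
    (fun x y => measure_sqSum_div_Ioc_pos hp) (sub_pos.2 hα') (sub_lt_self 1 hα)
  have hq0 : 0 < q := by
    by_contra! hq0
    have h1 : gaussianSeq.real {z | sqSum p₀ z / p₀ ≤ q} ≤
        gaussianSeq.real {z | sqSum p₀ z / p₀ = 0} :=
      measureReal_mono fun z (hz : _ ≤ _) => le_antisymm (hz.trans hq0)
        (div_nonneg (Finset.sum_nonneg fun i _ => sq_nonneg _) hp'.le)
    have h2 := hatom 0 0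
    simp only [shiftedSqSum_zero] at h2
    rw [hq, measureReal_def, h2, ENNReal.toReal_zero] at h1
    linarith
  refine ⟨1 - gaussianSeq.real {z | shiftedSqSum (c₀ / σ) p₀ z / p₀ ≤ q}, ?_, ?_, ?_⟩
  · have h1 := measure_shiftedSqSum_le_lt (k := p₀) hp hδ (mul_pos hq0 hp')
    have h2 := (ENNReal.toReal_lt_toReal (measure_ne_top _ _) (measure_ne_top _ _)).2 h1
    simp only [div_le_iff₀ hp', measureReal_def] at hq ⊢
    linarith
  · have hopen : IsOpen {z : ℕ → ℝ | shiftedSqSum (c₀ / σ) p₀ z / p₀ < q} :=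
      isOpen_lt (by fun_prop) (by fun_prop)
    -- the point `-δ e₀` cancels the shift
    have h1 := hopen.measure_pos gaussianSeq ⟨Pi.single 0 (-(c₀ / σ)), by
      simp only [Set.mem_ofPred_eq]
      rw [shiftedSqSum, sqSum_single hp, Pi.single_eq_same]
      ring_nf
      exact hq0⟩
    have hsub : {z : ℕ → ℝ | shiftedSqSum (c₀ / σ) p₀ z / p₀ < q} ⊆
        {z | shiftedSqSum (c₀ / σ) p₀ z / p₀ ≤ q} := by
      intro z hz
      simp only [Set.mem_ofPred_eq] at hz ⊢
      exact hz.le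
    have h2 : 0 < gaussianSeq.real {z | shiftedSqSum (c₀ / σ) p₀ z / p₀ ≤ q} :=
      ENNReal.toReal_pos (h1.trans_le (measure_mono hsub)).ne' (measure_ne_top _ _)
    linarith
  · have hΦ : ∀ δ x, Tendsto (fun n : ℕ => gaussianSeqPair.real
        {ω | 1 * (fRatio δ p₀ (n - p₀) ω - 0) ≤ x}) atTop
        (𝓝 (gaussianSeq.real {z | shiftedSqSum δ p₀ z / p₀ ≤ x})) := fun δ x => by
      simpa only [one_mul, sub_zero] using tendsto_cdf_fRatio_fixed hp δ x
    have h := tendsto_measureReal_lawQuantile_lt (P := gaussianSeqPair)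
      (G := fun n => fRatio 0 p₀ (n - p₀)) (H := fun n => fRatio (c₀ / σ) p₀ (n - p₀))
      (fun n => by fun_prop) (fun n => by fun_prop) (a := fun _ => 1) (b := fun _ => 0)
      (Eventually.of_forall fun _ => one_pos) (hΦ 0) (hΦ (c₀ / σ))
      (by simpa only [shiftedSqSum_zero] using hlt) (by simpa only [shiftedSqSum_zero] using hgt)
      (continuousAt_measureReal_le (by fun_prop) (hatom _ _))
    refine h.congr' ?_
    filter_upwards [hX, hβ, eventually_ge_atTop p₀] with n h1 h2 h3
    rw [fTestPower_eq _ _ _ hσ hp h3 h1, h2]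

/-- Limit of the power for `⌊γ n⌋` predictors, in terms of `d = lim δ² / √n`. The limiting variance
`V` and critical value `q` depend on `α` and `γ` only. -/
theorem exists_tendsto_fTestPower_proportional {α γ : ℝ} (hα : 0 < α) (hα' : α < 1) (hγ : 0 < γ)
    (hγ' : γ < 1) :
    ∃ (V : ℝ≥0) (q : ℝ), V ≠ 0 ∧ (gaussianReal 0 V).real (Set.Iic q) = 1 - α ∧
      (∀ x < q, (gaussianReal 0 V).real (Set.Iic x) < 1 - α) ∧
      ∀ (σ : ℝ), 0 < σ → ∀ (X : (n : ℕ) → Matrix (Fin n) (Fin ⌊γ * (n : ℝ)⌋₊) ℝ)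
        (β : (n : ℕ) → EuclideanSpace ℝ (Fin ⌊γ * (n : ℝ)⌋₊)) (δ : ℕ → ℝ) (d : ℝ),
        (∀ᶠ n in atTop, (X n).rank = ⌊γ * (n : ℝ)⌋₊) →
        (∀ᶠ n in atTop, ‖regressionMean (X n) (β n)‖ / σ = δ n) →
        Tendsto (fun n : ℕ => δ n / √n) atTop (𝓝 0) →
        Tendsto (fun n : ℕ => δ n ^ 2 / √n) atTop (𝓝 d) →
        Tendsto (fun n => fTestPower α σ (X n) (β n)) atTop
          (𝓝 (1 - (gaussianReal (d / γ) V).real (Set.Iic q))) := by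
  set p : ℕ → ℕ := fun n => ⌊γ * (n : ℝ)⌋₊ with hpdef
  set m : ℕ → ℕ := fun n => n - p n with hmdef
  have hpn : ∀ n, p n ≤ n := fun n => by
    rw [hpdef, ← Nat.floor_natCast (R := ℝ) n]
    exact Nat.floor_mono (by simpa using mul_le_of_le_one_left (Nat.cast_nonneg n) hγ'.le)
  have hratio : Tendsto (fun n : ℕ => (p n : ℝ) / n) atTop (𝓝 γ) :=
    (tendsto_nat_floor_mul_div_atTop hγ.le).comp tendsto_natCast_atTop_atTop
  have hratio' : Tendsto (fun n : ℕ => (m n : ℝ) / n) atTop (𝓝 (1 - γ)) := by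
    refine (hratio.const_sub 1).congr' ?_
    filter_upwards [eventually_gt_atTop 0] with n hn
    have : (n : ℝ) ≠ 0 := by exact_mod_cast hn.ne'
    rw [hmdef, Nat.cast_sub (hpn n), sub_div, div_self this]
  have hinf : ∀ {r : ℕ → ℕ} {c : ℝ}, 0 < c → Tendsto (fun n : ℕ => (r n : ℝ) / n) atTop (𝓝 c) →
      Tendsto r atTop atTop := by
    intro r c hc hr
    refine (tendsto_natCast_atTop_iff (R := ℝ)).1 ?_
    refine (hr.pos_mul_atTop hc tendsto_natCast_atTop_atTop).congr' ?_
    filter_upwards [eventually_gt_atTop 0] with n hn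
    have : (n : ℝ) ≠ 0 := by exact_mod_cast hn.ne'
    field_simp
  have hsqrt : ∀ {r : ℕ → ℕ} {c : ℝ}, 0 < c → Tendsto (fun n : ℕ => (r n : ℝ) / n) atTop (𝓝 c) →
      Tendsto (fun n : ℕ => √n / √(r n)) atTop (𝓝 (√c)⁻¹) := by
    intro r c hc hr
    refine (((Real.continuous_sqrt.tendsto c).comp hr).inv₀
      (Real.sqrt_pos.2 hc).ne').congr fun n => ?_
    simp [Real.sqrt_div]
  have hp := hinf hγ hratio
  have hm := hinf (sub_pos.2 hγ') hratio'
  have hcdf := fun (δ : ℕ → ℝ) (d : ℝ) h1 h2 => tendsto_cdf_fRatio hp hm (hsqrt hγ hratio)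
    (hsqrt (sub_pos.2 hγ') hratio') (inv_pos.2 (Real.sqrt_pos.2 hγ)) (δ := δ) (d := d) h1 h2
  set V : ℝ≥0 := NNReal.mk ((√γ)⁻¹ ^ 2) (sq_nonneg _) * varSq +
    NNReal.mk ((√(1 - γ))⁻¹ ^ 2) (sq_nonneg _) * varSq with hV
  have hV0 : V ≠ 0 := by
    have : (0 : ℝ≥0) < NNReal.mk ((√γ)⁻¹ ^ 2) (sq_nonneg _) * varSq :=
      mul_pos (by exact_mod_cast pow_pos (inv_pos.2 (Real.sqrt_pos.2 hγ)) 2) varSq_pos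
    exact (add_pos_of_pos_of_nonneg this zero_le).ne'
  have hatom : ∀ d x, gaussianReal d V {y | id y = x} = 0 := fun d x => by
    have := nullSingletonClass_gaussianReal (μ := d) hV0
    exact measure_singleton x
  have hopen := (gaussianReal_absolutelyContinuous' 0 hV0).isOpenPosMeasure
  obtain ⟨q, hq, hlt, hgt⟩ := exists_isolated_quantile (P := gaussianReal 0 V) measurable_id
    (hatom 0) (fun x y hxy _ => (isOpen_Ioo.measure_pos (gaussianReal 0 V)
      (Set.nonempty_Ioo.2 hxy)).trans_le (measure_mono fun z hz => ⟨hz.1, hz.2.le⟩))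
    (sub_pos.2 hα') (sub_lt_self 1 hα)
  refine ⟨V, q, hV0, hq, hlt, fun σ hσ X β δ d hX hβ hδ hδ2 => ?_⟩
  have hscale : ∀ {u : ℕ → ℝ} {c : ℝ}, Tendsto (fun n : ℕ => u n / √n) atTop (𝓝 c) →
      Tendsto (fun n : ℕ => √n / p n * u n) atTop (𝓝 (c / γ)) := by
    intro u c hu
    refine (hu.div hratio hγ.ne').congr fun n => ?_
    have h1 : u n / √n * n = u n * √n := by
      rw [div_mul_eq_mul_div, mul_div_assoc, Real.div_sqrt]
    simp only [Pi.div_apply]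
    rw [div_div_eq_mul_div, h1]
    ring
  have hH := hcdf δ (d / γ) (by simpa using hscale hδ) (hscale hδ2)
  have hG := hcdf (fun _ => 0) 0 (by simp) (by simp)
  have h := tendsto_measureReal_lawQuantile_lt (P := gaussianSeqPair)
    (G := fun n => fRatio 0 (p n) (m n)) (H := fun n => fRatio (δ n) (p n) (m n))
    (fun n => by fun_prop) (fun n => by fun_prop) (a := fun n => √n) (b := fun _ => 1)
    ((eventually_gt_atTop 0).mono fun n hn => Real.sqrt_pos.2 (by exact_mod_cast hn)) hG hH
    hlt hgt (continuousAt_measureReal_le measurable_id (hatom (d / γ) q))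
  refine h.congr' ?_
  filter_upwards [hX, hβ, hp.eventually_gt_atTop 0] with n h1 h2 h3
  rw [fTestPower_eq _ _ _ hσ h3 (hpn n) h1, h2]

theorem lemma2 (α σ : ℝ) (hα : 0 < α) (hα' : α < 1) (hσ : 0 < σ) :
    -- fixed number of predictors and fixed signal strength
    (∀ (p₀ : ℕ) (c₀ : ℝ), 1 ≤ p₀ → 0 < c₀ →
      ∀ (X : (n : ℕ) → Matrix (Fin n) (Fin p₀) ℝ) (β : ℕ → EuclideanSpace ℝ (Fin p₀)),
        (∀ᶠ n in atTop, (X n).rank = p₀) →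
        (∀ᶠ n in atTop, ‖regressionMean (X n) (β n)‖ = c₀) →
        α < liminf (fun n => fTestPower α σ (X n) (β n)) atTop ∧
          liminf (fun n => fTestPower α σ (X n) (β n)) atTop < 1) ∧
    -- number of predictors proportional to `n`
    (∀ γ : ℝ, 0 < γ → γ < 1 →
      ∀ (X : (n : ℕ) → Matrix (Fin n) (Fin ⌊γ * (n : ℝ)⌋₊) ℝ)
        (β : (n : ℕ) → EuclideanSpace ℝ (Fin ⌊γ * (n : ℝ)⌋₊)),
        (∀ᶠ n in atTop, (X n).rank = ⌊γ * (n : ℝ)⌋₊) →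
        -- fixed signal strength
        (∀ c₀ : ℝ, (∀ᶠ n in atTop, ‖regressionMean (X n) (β n)‖ = c₀) →
          liminf (fun n => fTestPower α σ (X n) (β n)) atTop = α) ∧
        -- signal strength `n ^ (1 / 4)`
        ((∀ᶠ n : ℕ in atTop, ‖regressionMean (X n) (β n)‖ = (n : ℝ) ^ (1 / 4 : ℝ)) →
          α < liminf (fun n => fTestPower α σ (X n) (β n)) atTop ∧
            liminf (fun n => fTestPower α σ (X n) (β n)) atTop < 1)) := by
  refine ⟨fun p₀ c₀ hp hc X β hX hβ => ?_, fun γ hγ hγ' X β hX => ?_⟩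
  · obtain ⟨L, h1, h2, h⟩ := exists_tendsto_fTestPower_fixed hα hα' hσ hp hc X β hX hβ
    rw [h.liminf_eq]
    exact ⟨h1, h2⟩
  obtain ⟨V, q, hV, hq, hlt, hlim⟩ := exists_tendsto_fTestPower_proportional hα hα' hγ hγ'
  have hsqrt : Tendsto (fun n : ℕ => √(n : ℝ)) atTop atTop :=
    Real.tendsto_sqrt_atTop.comp tendsto_natCast_atTop_atTop
  refine ⟨fun c₀ hβ => ?_, fun hβ => ?_⟩
  · have h := hlim σ hσ X β (fun _ => c₀ / σ) 0 hX (hβ.mono fun n hn => by rw [hn])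
      (hsqrt.const_div_atTop _) (hsqrt.const_div_atTop _)
    rw [h.liminf_eq, zero_div, hq]
    ring
  · have hroot : ∀ n : ℕ, ((n : ℝ) ^ (1 / 4 : ℝ)) ^ 2 = √n := fun n => by
      rw [← Real.rpow_natCast, ← Real.rpow_mul (Nat.cast_nonneg n), Real.sqrt_eq_rpow]
      norm_num
    have h := hlim σ hσ X β (fun n => (n : ℝ) ^ (1 / 4 : ℝ) / σ) (1 / σ ^ 2) hX
      (hβ.mono fun n hn => by rw [hn]) ?_ ?_
    · have hd : 0 < 1 / σ ^ 2 / γ := by positivity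
      -- `N(d / γ, V)` is the translate of `N(0, V)` by `d / γ`, here with `d = 1 / σ²`
      have hshift : (gaussianReal (1 / σ ^ 2 / γ) V).real (Set.Iic q) =
          (gaussianReal 0 V).real (Set.Iic (q - 1 / σ ^ 2 / γ)) := by
        rw [← zero_add (1 / σ ^ 2 / γ), ← gaussianReal_map_add_const,
          map_measureReal_apply (by fun_prop) measurableSet_Iic]
        congr 1
        ext x
        simp [le_sub_iff_add_le]
      have hopen := (gaussianReal_absolutelyContinuous' 0 hV).isOpenPosMeasure
      have hpos : 0 < (gaussianReal 0 V).real (Set.Iic (q - 1 / σ ^ 2 / γ)) :=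
        ENNReal.toReal_pos ((isOpen_Iio.measure_pos (gaussianReal 0 V)
          Set.nonempty_Iio).trans_le (measure_mono Set.Iio_subset_Iic_self)).ne' (measure_ne_top _ _)
      have := hlt _ (sub_lt_self q hd)
      rw [h.liminf_eq, hshift]
      constructor <;> linarith
    · have hquarter : Tendsto (fun n : ℕ => (n : ℝ) ^ (1 / 4 : ℝ)) atTop atTop :=
        (tendsto_rpow_atTop (by norm_num)).comp tendsto_natCast_atTop_atTop
      refine (hquarter.const_div_atTop (1 / σ)).congr fun n => ?_
      rw [← hroot n]
      generalize (n : ℝ) ^ (1 / 4 : ℝ) = r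
      by_cases h0 : r = 0
      · simp [h0]
      · field_simp
    · refine tendsto_const_nhds.congr' ?_
      filter_upwards [eventually_gt_atTop 0] with n hn
      have h0 : √(n : ℝ) ≠ 0 := (Real.sqrt_pos.2 (by exact_mod_cast hn)).ne'
      rw [div_pow, hroot]
      field_simp
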